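/- A two-way $k$-head nondeterministic finite automaton (2nfa($k$)) is a tuple $M=(Q,\Sigma,\delta,q_0,q_{\mathrm{acc}},q_{\mathrm{rej}})$ with a finite state set $Q$, a finite input alphabet $\Sigma$, states $q_0,q_{\mathrm{acc}},q_{\mathrm{rej}}\in Q$, and a transition function $\delta\colon Q\times\Gamma^k\to\mathcal P(Q\times\Delta^k)$, where $\Gamma=\Sigma\sqcup\{\rhd,\lhd\}$ and $\Delta=\{\text{left},\text{stay},\text{right}\}$. On input $x\in\Sigma^*$ it starts in state $q_0$ with all $k$ heads on the symbol $\rhd$ of the read-only tape $\rhd x\lhd$; in each step it picks some $(r,d)\in\delta(q,y)$, where $q$ is its state and $y\in\Gamma^k$ are the symbols under its heads, goes to state $r$ and moves its $i$-th head by $d_i$ (a head told to move past an end marker stays on it). A computational path halts if it reaches $q_{\mathrm{acc}}$ or $q_{\mathrm{rej}}$, or if $\delta$ offers no further step. $M$ is always halting if on every input every computational path halts. A 2nfa is a 2nfa($1$). For $1\le i\le k$ let $M_i$ be the 2nfa with the same states, alphabet, and initial, accept and reject states as $M$ and with the transition function $$\delta_i(q,x)=\bigcup_{y\in\Gamma^k,\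 y_i=x}\{(r,d_i)\mid (r,d)\in\delta(q,y)\}.$$ The $i$-th head of $M$ is safe if $M_i$ is always halting, and risky otherwise. Let $\langle M\rangle$ denote an encoding of $M$ that, with states and input symbols numbered, gives the numbers of heads, states and input symbols, the states $q_0,q_{\mathrm{acc}},q_{\mathrm{rej}}$, and a list of the transitions. Then: 1. The set $\{\langle M\rangle\mid M\text{ is an always halting 2nfa}\}$ is decidable. 2. The sets $\{(\langle M\rangle,i)\mid k\ge 1,\ M\text{ is a 2nfa}(k),\ 1\le i\le k,\ \text{the }i\text{-th head of }M\text{ is safe}\}$ and $\{(\langle M\rangle,i)\mid k\ge 1,\ M\text{ is a 2nfa}(k),\ 1\le i\le k,\ \text{the }i\text{-th head of }M\text{ is risky}\}$ are decidable. -/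

import Mathlib

/-- Tape symbols: the input symbols together with the left and right end markers. -/
inductive TapeSym (S : Type) : Type
  | leftEnd : TapeSym S
  | rightEnd : TapeSym S
  | sym (a : S) : TapeSym S

/-- Head movements: left, stay put, right. -/
inductive HeadMove : Type
  | left : HeadMove
  | stay : HeadMove
  | right : HeadMove

/-- A two-way `k`-head nondeterministic finite automaton with state set `Q` and input alphabet `S`
(both are finite wherever such automata are encoded below). -/
structure MultiheadNFA (k : ℕ) (Q S : Type) where
  /-- the transition function -/
  delta : Q → (Fin k → TapeSym S) → Set (Q × (Fin k → HeadMove))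
  /-- the initial state -/
  q0 : Q
  /-- the accept state -/
  qacc : Q
  /-- the reject state -/
  qrej : Q

/-- The symbol in cell `p` of the tape holding the left end marker (cell `0`), the input `x`
(cells `1, …, |x|`), and the right end marker (cell `|x| + 1`). -/
def readTape {S : Type} (x : List S) (p : Fin (x.length + 2)) : TapeSym S :=
  if p.val = 0 then TapeSym.leftEnd
  else match x[p.val - 1]? with
    | some a => TapeSym.sym a
    | none => TapeSym.rightEnd

/-- The new position of a head on a tape of `N + 2` cells.  A head that is told to move past an
end marker stays on the end marker. -/
def moveHead {N : ℕ} (p : Fin (N + 2)) : HeadMove → Fin (N + 2)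
  | HeadMove.left => ⟨p.val - 1, by omega⟩
  | HeadMove.stay => p
  | HeadMove.right => ⟨min (p.val + 1) (N + 1), by omega⟩

namespace MultiheadNFA

/-- Configurations on the input `x`: the state and the positions of the `k` heads. -/
abbrev Config {S : Type} (k : ℕ) (Q : Type) (x : List S) : Type :=
  Q × (Fin k → Fin (x.length + 2))

variable {k : ℕ} {Q S : Type}

/-- The initial configuration: initial state, all heads on the left end marker. -/
def initConfig (M : MultiheadNFA k Q S) (x : List S) : Config k Q x :=
  (M.q0, fun _ => 0)

/-- The alternatives that the transition function offers in a configuration. -/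
def options (M : MultiheadNFA k Q S) {x : List S} (c : Config k Q x) :
    Set (Q × (Fin k → HeadMove)) :=
  M.delta c.1 (fun j => readTape x (c.2 j))

/-- `c'` results from `c` by picking one of the offered alternatives. -/
def Step (M : MultiheadNFA k Q S) {x : List S} (c c' : Config k Q x) : Prop :=
  ∃ e ∈ M.options c, c' = (e.1, fun j => moveHead (c.2 j) (e.2 j))

/-- The computation halts in `c`: accept state, reject state, or no further alternative. -/
def Halted (M : MultiheadNFA k Q S) {x : List S} (c : Config k Q x) : Prop :=
  c.1 = M.qacc ∨ c.1 = M.qrej ∨ M.options c = ∅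

/-- A computational path on `x`, as an infinite sequence: it starts in the initial configuration,
makes a step as long as it has not halted, and is constant from the moment it halts. -/
def IsPath (M : MultiheadNFA k Q S) (x : List S) (p : ℕ → Config k Q x) : Prop :=
  p 0 = M.initConfig x ∧
    ∀ t, (¬ M.Halted (p t) → M.Step (p t) (p (t + 1))) ∧ (M.Halted (p t) → p (t + 1) = p t)

/-- On every input string, every computational path halts. -/
def AlwaysHalting (M : MultiheadNFA k Q S) : Prop :=
  ∀ (x : List S) (p : ℕ → Config k Q x), M.IsPath x p → ∃ t, M.Halted (p t)

/-- The one-head automaton `M_i` of the `i`-th head of `M`: on reading `z` it may make the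
`i`-th part of any transition of `M` in which the `i`-th head reads `z`. -/
def headNFA (M : MultiheadNFA k Q S) (i : Fin k) : MultiheadNFA 1 Q S where
  delta q z := {e | ∃ y : Fin k → TapeSym S, y i = z 0 ∧
    ∃ r d, (r, d) ∈ M.delta q y ∧ e = (r, fun _ => d i)}
  q0 := M.q0
  qacc := M.qacc
  qrej := M.qrej

/-- The `i`-th head of `M` is safe. -/
def SafeHead (M : MultiheadNFA k Q S) (i : Fin k) : Prop :=
  (M.headNFA i).AlwaysHalting

/-- The `i`-th head of `M` is risky. -/
def RiskyHead (M : MultiheadNFA k Q S) (i : Fin k) : Prop :=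
  ¬ (M.headNFA i).AlwaysHalting

end MultiheadNFA

/-- A written transition: state, symbols read, new state, head movements. -/
abbrev TransitionCode : Type := ℕ × List ℕ × ℕ × List ℕ

/-- A written automaton: number of heads, number of states, number of input symbols, initial
state, accept state, reject state, and a list of transitions. -/
abbrev AutomatonCode : Type := ℕ × ℕ × ℕ × ℕ × ℕ × ℕ × List TransitionCode

/-- The number of a tape symbol. -/
def TapeSym.code {m : ℕ} : TapeSym (Fin m) → ℕ
  | TapeSym.leftEnd => 0
  | TapeSym.rightEnd => 1
  | TapeSym.sym a => a.val + 2

/-- The number of a head movement. -/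
def HeadMove.code : HeadMove → ℕ
  | HeadMove.left => 0
  | HeadMove.stay => 1
  | HeadMove.right => 2

/-- The written form of the transition `(r, d) ∈ δ(q, y)`. -/
def transitionCode {k n m : ℕ} (q : Fin n) (y : Fin k → TapeSym (Fin m)) (r : Fin n)
    (d : Fin k → HeadMove) : TransitionCode :=
  (q.val, List.ofFn (fun j => (y j).code), r.val, List.ofFn (fun j => (d j).code))

/-- `c` is an encoding of `M`, an automaton with states `0, …, n - 1` and input symbols
`0, …, m - 1`: it states all the parameters of `M` and a list, in any order, of exactly the
transitions of `M`. -/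
def Encodes {k n m : ℕ} (c : AutomatonCode) (M : MultiheadNFA k (Fin n) (Fin m)) : Prop :=
  ∃ L : List TransitionCode,
    c = (k, n, m, M.q0.val, M.qacc.val, M.qrej.val, L) ∧
    ∀ e, e ∈ L ↔ ∃ q y r d, (r, d) ∈ M.delta q y ∧ e = transitionCode q y r d

theorem TapeSym.code_injective {m : ℕ} : Function.Injective (TapeSym.code (m := m)) := by
  intro a b h
  cases a <;> cases b <;> simp_all [TapeSym.code, Fin.ext_iff]

theorem HeadMove.code_injective : Function.Injective HeadMove.code := by
  intro a b h
  cases a <;> cases b <;> simp_all [HeadMove.code]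

instance : Finite HeadMove :=
  Finite.of_injective (fun a : HeadMove => (⟨a.code, by cases a <;> simp [HeadMove.code]⟩ : Fin 3))
    (fun _ _ h => HeadMove.code_injective (Fin.ext_iff.mp h))

instance {m : ℕ} : Finite (TapeSym (Fin m)) :=
  Finite.of_injective
    (fun a : TapeSym (Fin m) =>
      (⟨a.code, by cases a <;> simp [TapeSym.code]⟩ : Fin (m + 2)))
    (fun _ _ h => TapeSym.code_injective (Fin.ext_iff.mp h))

/-- Every automaton has an encoding. -/
theorem exists_encodes {k n m : ℕ} (M : MultiheadNFA k (Fin n) (Fin m)) :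
    ∃ c, Encodes c M := by
  classical
  let f : Fin n × (Fin k → TapeSym (Fin m)) × Fin n × (Fin k → HeadMove) → TransitionCode :=
    fun t => transitionCode t.1 t.2.1 t.2.2.1 t.2.2.2
  have hfin : (f '' {t | (t.2.2.1, t.2.2.2) ∈ M.delta t.1 t.2.1}).Finite := Set.toFinite _
  refine ⟨_, hfin.toFinset.toList, rfl, fun e => ?_⟩
  simp only [Finset.mem_toList, Set.Finite.mem_toFinset, Set.mem_image, Set.mem_ofPred_eq]
  constructor
  · rintro ⟨⟨q, y, r, d⟩, h, rfl⟩
    exact ⟨q, y, r, d, h, rfl⟩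
  · rintro ⟨q, y, r, d, h, rfl⟩
    exact ⟨⟨q, y, r, d⟩, h, rfl⟩

/-- An encoding determines the automaton. -/
theorem encodes_unique {k n m : ℕ} {c : AutomatonCode} {M M' : MultiheadNFA k (Fin n) (Fin m)}
    (h : Encodes c M) (h' : Encodes c M') : M = M' := by
  obtain ⟨L, rfl, hL⟩ := h
  obtain ⟨L', e, hL'⟩ := h'
  simp only [Prod.mk.injEq, true_and] at e
  obtain ⟨h0, h1, h2, rfl⟩ := e
  have key : ∀ (A B : MultiheadNFA k (Fin n) (Fin m)),
      (∀ e, e ∈ L ↔ ∃ q y r d, (r, d) ∈ A.delta q y ∧ e = transitionCode q y r d) →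
      (∀ e, e ∈ L ↔ ∃ q y r d, (r, d) ∈ B.delta q y ∧ e = transitionCode q y r d) →
      ∀ q y r d, (r, d) ∈ A.delta q y → (r, d) ∈ B.delta q y := by
    intro A B hA hB q y r d h
    obtain ⟨q', y', r', d', h', e⟩ := (hB _).1 ((hA _).2 ⟨q, y, r, d, h, rfl⟩)
    simp only [transitionCode, Prod.mk.injEq, List.ofFn_inj] at e
    obtain ⟨e1, e2, e3, e4⟩ := e
    have e1 := Fin.ext e1
    have e3 := Fin.ext e3
    have e2 : y = y' := funext fun j => TapeSym.code_injective (congrFun e2 j)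
    have e4 : d = d' := funext fun j => HeadMove.code_injective (congrFun e4 j)
    subst e1 e2 e3 e4
    exact h'
  have hd : M.delta = M'.delta := by
    funext q y
    ext ⟨r, d⟩
    exact ⟨key M M' hL hL' q y r d, key M' M hL' hL q y r d⟩
  cases M
  cases M'
  simp only [MultiheadNFA.mk.injEq]
  exact ⟨hd, Fin.ext h0, Fin.ext h1, Fin.ext h2⟩

/-- The set of encodings of always halting one-head automata. -/
def Decider2NFA : Set AutomatonCode :=
  {c | ∃ (n m : ℕ) (M : MultiheadNFA 1 (Fin n) (Fin m)), Encodes c M ∧ M.AlwaysHalting}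

/-- The set of pairs (encoding of a multi-head automaton, index of a safe head of it), where
heads are numbered from `0`. -/
def SafeHeads : Set (AutomatonCode × ℕ) :=
  {p | ∃ (k n m : ℕ) (M : MultiheadNFA k (Fin n) (Fin m)) (i : Fin k),
    Encodes p.1 M ∧ p.2 = i.val ∧ M.SafeHead i}

/-- The set of pairs (encoding of a multi-head automaton, index of a risky head of it), where
heads are numbered from `0`. -/
def RiskyHeads : Set (AutomatonCode × ℕ) :=
  {p | ∃ (k n m : ℕ) (M : MultiheadNFA k (Fin n) (Fin m)) (i : Fin k),
    Encodes p.1 M ∧ p.2 = i.val ∧ M.RiskyHead i}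

/-! A one-head automaton with a nonterminating computation on some input has one on an input of
bounded length. The cells `0, …, j` affect the rest of a computation only through a finite table:
for the start in cell `0` and for each state in which cell `j` is entered from the right, whether
all computations inside these cells are finite, and in which states they can be left. With `n`
states this table is an `(n + 1) × (n + 1)` Boolean matrix (`behaviour`). If two prefixes of an
input have the same matrix, cutting out the part between them preserves nontermination
(`terminates_of_behaviour_eq`), so a shortest nonterminating input has length at most `2 ^ ((n + 1)
* (n + 1))` (`exists_short_not_terminates`).

On a fixed input `x` there are at most `n * (|x| + 2)` configurations, so a computation of that many
steps repeats one and can be continued forever; conversely, nontermination yields computations of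
every length. Nontermination is therefore detected by running all computations on all short words
for a fixed number of steps (`longRuns_ne_nil_iff`), a bounded search that is primitive recursive.

Safety of a head is this property for the automaton `M_i`, whose transition table is read off the
code of `M`. A one-head automaton is its own `M_i`, so the first set reduces to safety of head `0`.
Validity of a code is a bounded check. -/

/-! ### Numbered one-head computations and their restriction to a prefix of the tape -/

/-- Transitions of a one-head automaton with all components numbered: state, symbol read, new
state, movement. -/
abbrev OneHeadTable : Type := List (ℕ × ℕ × ℕ × ℕ)

/-- The number of the symbol in cell `p` of the tape holding the numbered input `x`. -/
def readNum (x : List ℕ) (p : ℕ) : ℕ :=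
  if p = 0 then 0 else (x[p - 1]?.map (· + 2)).getD 1

/-- The new position of a head on a tape of `N + 2` cells under the movement with number `d`. -/
def moveNum (N d p : ℕ) : ℕ :=
  if d = 0 then p - 1 else if d = 1 then p else min (p + 1) (N + 1)

/-- One step between numbered configurations (state, position) on the input `x`. -/
def NumStep (E : OneHeadTable) (x : List ℕ) (c c' : ℕ × ℕ) : Prop :=
  ∃ d, (c.1, readNum x c.2, c'.1, d) ∈ E ∧ c'.2 = moveNum x.length d c.2

/-- All computations on `x` from the configuration `c` are finite. -/
abbrev Terminates (E : OneHeadTable) (x : List ℕ) (c : ℕ × ℕ) : Prop :=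
  Acc (fun a b => NumStep E x b a) c

/-- A step that starts and ends in the cells `0, …, j`. -/
def InnerStep (E : OneHeadTable) (x : List ℕ) (j : ℕ) (c b : ℕ × ℕ) : Prop :=
  NumStep E x c b ∧ c.2 ≤ j ∧ b.2 ≤ j

/-- All computations from `c` that stay within the cells `0, …, j` are finite. -/
abbrev InnerTerminates (E : OneHeadTable) (x : List ℕ) (j : ℕ) (c : ℕ × ℕ) : Prop :=
  Acc (fun a b => InnerStep E x j b a) c

/-- From `c` the head can leave the cells `0, …, j` to the right, arriving in state `r`. -/
def ExitsIn (E : OneHeadTable) (x : List ℕ) (j : ℕ) (c : ℕ × ℕ) (r : ℕ) : Prop :=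
  ∃ b, Relation.ReflTransGen (InnerStep E x j) c b ∧ b.2 ≤ j ∧ NumStep E x b (r, j + 1)

section

variable {E : OneHeadTable} {x x' : List ℕ} {i j n : ℕ}

theorem Acc.not_rel_self {α : Type*} {r : α → α → Prop} {a : α} (h : Acc r a) : ¬ r a a := by
  induction h with
  | intro a _ ih => exact fun h => ih a h h

theorem Terminates.inner {c : ℕ × ℕ} (h : Terminates E x c) : InnerTerminates E x j c :=
  Subrelation.accessible (fun h => h.1) h

theorem NumStep.snd_le {c c' : ℕ × ℕ} (h : NumStep E x c c') : c'.2 ≤ c.2 + 1 := by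
  obtain ⟨d, -, h⟩ := h
  rw [h, moveNum]
  split_ifs <;> omega

theorem ExitsIn.transGen {c : ℕ × ℕ} {r : ℕ} (h : ExitsIn E x j c r) :
    Relation.TransGen (NumStep E x) c (r, j + 1) := by
  obtain ⟨b, hb, -, hs⟩ := h
  exact Relation.TransGen.tail' (hb.lift id fun _ _ h => h.1) hs

theorem Terminates.of_transGen {c c' : ℕ × ℕ} (h : Terminates E x c)
    (hs : Relation.TransGen (NumStep E x) c c') : Terminates E x c' := by
  induction hs with
  | single hs => exact h.inv hs
  | tail _ hs ih => exact ih.inv hs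

/-- A step moves the head by at most one cell, so a computation that does not stay in the cells `0,
…, j` first leaves them into cell `j + 1`. -/
theorem terminates_of_inner {c : ℕ × ℕ} (h : InnerTerminates E x j c) (hc : c.2 ≤ j)
    (hr : ∀ r, ExitsIn E x j c r → Terminates E x (r, j + 1)) : Terminates E x c := by
  induction h with
  | intro c _ ih =>
    refine ⟨_, fun c' hs => ?_⟩
    by_cases hc' : c'.2 ≤ j
    · refine ih c' ⟨hs, hc, hc'⟩ hc' fun r hr' => hr r ?_
      obtain ⟨b, hb, hb'⟩ := hr'
      exact ⟨b, Relation.ReflTransGen.head ⟨hs, hc, hc'⟩ hb, hb'⟩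
    · have h1 := hs.snd_le
      have h2 : c' = (c'.1, j + 1) := Prod.ext rfl (by simp only; omega)
      rw [h2] at hs ⊢
      exact hr _ ⟨c, .refl, hc, hs⟩

/-! ### Replacing a prefix, and short nonterminating inputs -/

/-- Behaviour of the prefix `x'` of length `i` subsumes that of the prefix of `x` of length `j`,
on entering from the right. -/
def Subsumes (E : OneHeadTable) (n : ℕ) (x' : List ℕ) (i : ℕ) (x : List ℕ) (j : ℕ) : Prop :=
  ∀ q < n, (InnerTerminates E x' i (q, i) → InnerTerminates E x j (q, j)) ∧
    ∀ r < n, ExitsIn E x j (q, j) r → ExitsIn E x' i (q, i) r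

theorem NumStep.fst_lt (hE : ∀ e ∈ E, e.2.2.1 < n) {c c' : ℕ × ℕ} (h : NumStep E x c c') :
    c'.1 < n := by
  obtain ⟨d, h, -⟩ := h
  exact hE _ h

theorem ExitsIn.lt (hE : ∀ e ∈ E, e.2.2.1 < n) {c : ℕ × ℕ} {r : ℕ} (h : ExitsIn E x j c r) :
    r < n := by
  obtain ⟨b, -, -, h⟩ := h
  exact h.fst_lt hE

/-- A computation on `x` is replayed on `x'`. To the right of the prefixes the two tapes agree up to
a shift and steps are copied; an excursion of `x` into its prefix is replaced by one of `x'` with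
the same entry and exit states, and it cannot go on forever since the one in `x'` cannot. -/
theorem terminates_right_part (hE : ∀ e ∈ E, e.2.2.1 < n)
    (hread : ∀ s, readNum x (j + 1 + s) = readNum x' (i + 1 + s))
    (hlen : x.length + i = x'.length + j) (hj : j ≤ x.length)
    (hsub : Subsumes E n x' i x j) {c : ℕ × ℕ} (hc : Terminates E x' c) :
    ∀ s, c.2 = i + 1 + s → Terminates E x (c.1, j + 1 + s) := by
  -- One excursion on `x'` takes several steps, so the induction runs along the transitive closure.
  have key := hc.transGen
  clear hc
  induction key with
  | intro c hacc ih =>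
    have hc : Terminates E x' c := by
      exact ⟨_, fun y hy => acc_transGen_iff.1 (hacc y (.single hy))⟩
    have ih' : ∀ y, Relation.TransGen (NumStep E x') c y → ∀ s, y.2 = i + 1 + s →
        Terminates E x (y.1, j + 1 + s) := fun y hy =>
      ih y (Relation.transGen_swap.2 hy)
    intro s hs
    refine ⟨_, ?_⟩
    rintro ⟨q, p⟩ ⟨d, hd, hp⟩
    simp only at hd hp
    have hstep : NumStep E x' c (q, moveNum x'.length d c.2) :=
      ⟨d, by rw [hs, ← hread]; exact hd, rfl⟩
    by_cases hpj : j + 1 ≤ p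
    · obtain ⟨t, rfl⟩ := Nat.exists_eq_add_of_le hpj
      refine ih' _ (.single hstep) t ?_
      simp only [hs]
      simp only [moveNum] at hp ⊢
      split_ifs at hp ⊢ <;> omega
    -- The step enters the prefix: this is possible only by a left move from the cell just outside
    -- it, and the copied step then arrives in cell `i`.
    · have hp' : p = j ∧ moveNum x'.length d c.2 = i := by
        rw [hs]
        simp only [moveNum] at hp ⊢
        split_ifs at hp ⊢ <;> omega
      obtain ⟨rfl, hm⟩ := hp'
      rw [hm] at hstep
      obtain ⟨h1, h2⟩ := hsub q (hstep.fst_lt hE)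
      refine terminates_of_inner (h1 (Terminates.inner (hc.inv hstep))) le_rfl fun r hr => ?_
      have hr' := h2 r (hr.lt hE) hr
      exact ih' (r, i + 1) (.head hstep hr'.transGen) 0 rfl

theorem terminates_of_subsumes (hE : ∀ e ∈ E, e.2.2.1 < n)
    (hread : ∀ s, readNum x (j + 1 + s) = readNum x' (i + 1 + s))
    (hlen : x.length + i = x'.length + j) (hj : j ≤ x.length)
    (hsub : Subsumes E n x' i x j) {q : ℕ}
    (h0 : InnerTerminates E x' i (q, 0) → InnerTerminates E x j (q, 0))
    (h0' : ∀ r < n, ExitsIn E x j (q, 0) r → ExitsIn E x' i (q, 0) r)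
    (h : Terminates E x' (q, 0)) : Terminates E x (q, 0) := by
  refine terminates_of_inner (h0 h.inner) (Nat.zero_le _) fun r hr => ?_
  have hr' := h0' r (hr.lt hE) hr
  exact terminates_right_part hE hread hlen hj hsub (h.of_transGen hr'.transGen) 0 rfl

/-- Words with a common prefix of length `i` have the same inner steps in it. -/
theorem innerStep_congr (hread : ∀ p ≤ i, readNum x p = readNum x' p)
    (hi : i ≤ x.length) (hi' : i ≤ x'.length) : InnerStep E x i = InnerStep E x' i := by
  funext c c'
  refine propext ⟨?_, ?_⟩ <;> rintro ⟨⟨d, hd, hm⟩, h1, h2⟩ <;> refine ⟨⟨d, ?_, ?_⟩, h1, h2⟩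
  · rwa [← hread _ h1]
  -- Both tapes have a cell `i + 1`, so a right move from a cell up to `i` is not cut off at the end
  -- of either tape.
  · rw [hm]; unfold moveNum; split_ifs <;> omega
  · rwa [hread _ h1]
  · rw [hm]; unfold moveNum; split_ifs <;> omega

theorem exitsIn_congr (hread : ∀ p ≤ i, readNum x p = readNum x' p)
    (hi : i ≤ x.length) (hi' : i ≤ x'.length) : ExitsIn E x i = ExitsIn E x' i := by
  funext c r
  unfold ExitsIn
  rw [innerStep_congr hread hi hi']
  refine propext ⟨?_, ?_⟩ <;> rintro ⟨b, hb, hbi, ⟨d, hd, hm⟩⟩ <;>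
    refine ⟨b, hb, hbi, ⟨d, ?_, ?_⟩⟩
  · rwa [← hread _ hbi]
  · simp only at hm ⊢; rw [hm]; unfold moveNum; split_ifs <;> omega
  · rwa [hread _ hbi]
  · simp only at hm ⊢; rw [hm]; unfold moveNum; split_ifs <;> omega

/-- The behaviour of the prefix of `x` of length `j`: row `n` is for the start in the initial
state `q` in cell `0`, the other rows are for entering cell `j`; column `n` is for termination
within the prefix, the other columns are for leaving it in the given state. -/
def behaviour (E : OneHeadTable) (n q : ℕ) (x : List ℕ) (j : ℕ) (a b : Fin (n + 1)) : Prop :=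
  let c : ℕ × ℕ := if a.val < n then (a.val, j) else (q, 0)
  if b.val < n then ExitsIn E x j c b.val else InnerTerminates E x j c

theorem readNum_take_append {v : List ℕ} (hi : i ≤ x.length) {p : ℕ} (hp : p ≤ i) :
    readNum (x.take i ++ v) p = readNum x p := by
  unfold readNum
  split_ifs with h
  · rfl
  · rw [List.getElem?_append_left (by rw [List.length_take]; omega),
      List.getElem?_take_of_lt (by omega)]

theorem readNum_append_drop {u : List ℕ} (s : ℕ) :
    readNum x (j + 1 + s) = readNum (u ++ x.drop j) (u.length + 1 + s) := by
  unfold readNum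
  rw [if_neg (by omega), if_neg (by omega), List.getElem?_append_right (by omega),
    List.getElem?_drop]
  congr 3
  omega

/-- Cutting out the part between two prefixes of equal behaviour preserves nontermination. -/
theorem terminates_of_behaviour_eq (hE : ∀ e ∈ E, e.2.2.1 < n) {q : ℕ} (hij : i ≤ j)
    (hj : j ≤ x.length) (hb : behaviour E n q x i = behaviour E n q x j)
    (h : Terminates E (x.take i ++ x.drop j) (q, 0)) : Terminates E x (q, 0) := by
  have hi : i ≤ x.length := hij.trans hj
  have hlt : (x.take i).length = i := by rw [List.length_take]; omega
  have hi' : i ≤ (x.take i ++ x.drop j).length := by simp; omega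
  have hread : ∀ p ≤ i, readNum x p = readNum (x.take i ++ x.drop j) p :=
    fun p hp => (readNum_take_append hi hp).symm
  have hI : InnerTerminates E x i = InnerTerminates E (x.take i ++ x.drop j) i := by
    unfold InnerTerminates
    rw [innerStep_congr hread hi hi']
  have hX := exitsIn_congr (E := E) hread hi hi'
  have hb' (a b : Fin (n + 1)) := congrFun (congrFun hb a) b
  have e1 : ∀ a < n, InnerTerminates E x i (a, i) = InnerTerminates E x j (a, j) := by
    intro a ha
    simpa [behaviour, ha] using hb' ⟨a, by omega⟩ (Fin.last n)
  have e2 : ∀ a < n, ∀ r < n, ExitsIn E x i (a, i) r = ExitsIn E x j (a, j) r := by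
    intro a ha r hr
    simpa [behaviour, ha, hr] using hb' ⟨a, by omega⟩ ⟨r, by omega⟩
  have e3 : InnerTerminates E x i (q, 0) = InnerTerminates E x j (q, 0) := by
    simpa [behaviour] using hb' (Fin.last n) (Fin.last n)
  have e4 : ∀ r < n, ExitsIn E x i (q, 0) r = ExitsIn E x j (q, 0) r := by
    intro r hr
    simpa [behaviour, hr] using hb' (Fin.last n) ⟨r, by omega⟩
  refine terminates_of_subsumes hE (i := i) (j := j) (fun s => ?_) (by simp; omega) hj ?_ ?_ ?_ h
  · have := readNum_append_drop (x := x) (j := j) (u := x.take i) s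
    rwa [hlt] at this
  · intro a ha
    rw [← hI, ← hX, e1 a ha]
    exact ⟨id, fun r hr => by rw [e2 a ha r hr]; exact id⟩
  · rw [← hI, e3]; exact id
  · intro r hr
    rw [← hX, e4 r hr]; exact id

/-- A nonterminating input can be chosen short. -/
theorem exists_short_not_terminates (hE : ∀ e ∈ E, e.2.2.1 < n) {q m : ℕ}
    (h : ∃ x : List ℕ, (∀ a ∈ x, a < m) ∧ ¬ Terminates E x (q, 0)) :
    ∃ x : List ℕ, x.length ≤ 2 ^ ((n + 1) * (n + 1)) ∧ (∀ a ∈ x, a < m) ∧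
      ¬ Terminates E x (q, 0) := by
  obtain ⟨x, hx⟩ := h
  induction hl : x.length using Nat.strong_induction_on generalizing x with
  | _ l ih =>
    subst hl
    by_cases hs : x.length ≤ 2 ^ ((n + 1) * (n + 1))
    · exact ⟨x, hs, hx⟩
    -- There are `2 ^ ((n + 1) * (n + 1))` matrices, fewer than the prefix lengths `0, …, |x| - 1`.
    have hcard : Fintype.card (Fin (n + 1) → Fin (n + 1) → Prop) < Fintype.card (Fin x.length) := by
      simp only [Fintype.card_fun, Fintype.card_fin, Fintype.card_prop, ← pow_mul]
      omega
    obtain ⟨i, j, hne, hb⟩ := Fintype.exists_ne_map_eq_of_card_lt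
      (fun i : Fin x.length => behaviour E n q x i) hcard
    have main : ∀ i j : Fin x.length, i < j → behaviour E n q x i = behaviour E n q x j →
        ∃ x : List ℕ, x.length ≤ 2 ^ ((n + 1) * (n + 1)) ∧ (∀ a ∈ x, a < m) ∧
          ¬ Terminates E x (q, 0) := by
      intro i j hij hb
      have hij' : i.val < j.val := hij
      have hj := j.isLt
      refine ih (x.take i ++ x.drop j).length ?_ (x.take i ++ x.drop j) ⟨?_, ?_⟩ rfl
      · simp; omega
      · intro a ha
        rcases List.mem_append.1 ha with ha | ha
        · exact hx.1 a (List.mem_of_mem_take ha)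
        · exact hx.1 a (List.mem_of_mem_drop ha)
      · exact fun h => hx.2 (terminates_of_behaviour_eq hE hij'.le hj.le hb h)
    rcases lt_or_gt_of_ne hne with h | h
    · exact main i j h hb
    · exact main j i h hb.symm

/-! ### Nontermination and long computations -/

/-- `NumPath E x t c c'`: there is a computation of `t` steps from `c` to `c'`. -/
def NumPath (E : OneHeadTable) (x : List ℕ) : ℕ → ℕ × ℕ → ℕ × ℕ → Prop
  | 0, c, c' => c' = c
  | t + 1, c, c' => ∃ b, NumPath E x t c b ∧ NumStep E x b c'

theorem exists_numPath_of_not_terminates {c : ℕ × ℕ} (h : ¬ Terminates E x c) (t : ℕ) :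
    ∃ c', NumPath E x t c c' := by
  -- The induction needs the endpoint to be nonterminating as well: such a configuration has a
  -- nonterminating successor.
  suffices ∃ c', NumPath E x t c c' ∧ ¬ Terminates E x c' from this.imp fun _ => And.left
  induction t with
  | zero => exact ⟨c, rfl, h⟩
  | succ t ih =>
    obtain ⟨b, hb, hn⟩ := ih
    by_contra! hcon
    exact hn ⟨_, fun y hy => hcon y ⟨b, hb, hy⟩⟩

theorem NumPath.exists_seq {t : ℕ} {c c' : ℕ × ℕ} (h : NumPath E x t c c') :
    ∃ f : ℕ → ℕ × ℕ, f 0 = c ∧ f t = c' ∧ ∀ s < t, NumStep E x (f s) (f (s + 1)) := by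
  induction t generalizing c' with
  | zero => exact ⟨fun _ => c, rfl, h.symm, by simp⟩
  | succ t ih =>
    obtain ⟨b, hb, hs⟩ := h
    obtain ⟨f, h0, ht, hf⟩ := ih hb
    refine ⟨fun s => if s ≤ t then f s else c', by simp [h0], by simp, fun s hst => ?_⟩
    rcases Nat.lt_succ_iff_lt_or_eq.1 hst with h | rfl
    · simpa [h.le, Nat.succ_le_of_lt h] using hf s h
    · simpa [ht] using hs

theorem NumStep.snd_lt {c c' : ℕ × ℕ} (h : NumStep E x c c') (hc : c.2 < x.length + 2) :
    c'.2 < x.length + 2 := by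
  obtain ⟨d, -, h⟩ := h
  rw [h, moveNum]
  split_ifs <;> omega

/-- A computation longer than the number of configurations shows nontermination. -/
theorem NumPath.not_terminates (hE : ∀ e ∈ E, e.2.2.1 < n) {t : ℕ} {c c' : ℕ × ℕ}
    (h : NumPath E x t c c') (hc1 : c.1 < n) (hc2 : c.2 < x.length + 2)
    (ht : n * (x.length + 2) ≤ t) : ¬ Terminates E x c := by
  obtain ⟨f, h0, -, hf⟩ := h.exists_seq
  have hb : ∀ s ≤ t, (f s).1 < n ∧ (f s).2 < x.length + 2 := by
    intro s
    induction s with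
    | zero => intro _; rw [h0]; exact ⟨hc1, hc2⟩
    | succ s ih =>
      intro hs
      exact ⟨(hf s hs).fst_lt hE, (hf s hs).snd_lt (ih (by omega)).2⟩
  have htrans : ∀ a b, a < b → b ≤ t → Relation.TransGen (NumStep E x) (f a) (f b) := by
    intro a b hab
    induction b, hab using Nat.le_induction with
    | base => exact fun h => .single (hf a h)
    | succ b hb ih => exact fun h => (ih (by omega)).tail (hf b h)
  -- The `t + 1` configurations visited outnumber the `n * (|x| + 2)` available ones.
  obtain ⟨a, b, hne, heq⟩ := Fintype.exists_ne_map_eq_of_card_lt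
    (fun s : Fin (t + 1) => ((⟨(f s).1, (hb s (by omega)).1⟩, ⟨(f s).2, (hb s (by omega)).2⟩) :
      Fin n × Fin (x.length + 2))) (by simp; omega)
  have hfab : f a = f b := by
    simp only [Prod.mk.injEq, Fin.mk.injEq] at heq
    exact Prod.ext heq.1 heq.2
  have main : ∀ a b : ℕ, a < b → b ≤ t → f a = f b → ¬ Terminates E x c := by
    intro a b hab hbt hfab hT
    have hTa : Terminates E x (f a) := by
      rcases Nat.eq_zero_or_pos a with rfl | ha
      · rwa [h0]
      · exact hT.of_transGen (h0 ▸ htrans 0 a ha (by omega))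
    have hloop := htrans a b hab hbt
    rw [← hfab] at hloop
    exact hTa.transGen.not_rel_self (Relation.transGen_swap.2 hloop)
  rcases lt_or_gt_of_ne hne with h | h
  · exact main a b h (by omega) hfab
  · exact main b a h (by omega) hfab.symm

/-! ### The bounded search for a long computation -/

/-- The list of all words of length at most `B` over the symbols `0, …, m - 1`. -/
def wordsUpTo (m B : ℕ) : List (List ℕ) :=
  Nat.rec [[]] (fun _ l => [] :: l.flatMap fun x => (List.range m).map fun a => a :: x) B

theorem mem_wordsUpTo {m B : ℕ} {x : List ℕ} :
    x ∈ wordsUpTo m B ↔ x.length ≤ B ∧ ∀ a ∈ x, a < m := by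
  induction B generalizing x with
  | zero => cases x <;> simp [wordsUpTo]
  | succ B ih =>
    change x ∈ [] :: (wordsUpTo m B).flatMap _ ↔ _
    cases x with
    | nil => simp
    | cons a x =>
      simp only [List.mem_cons, reduceCtorEq, false_or, List.mem_flatMap, List.mem_map,
        List.mem_range, List.cons.injEq, List.length_cons, forall_eq_or_imp, ih]
      constructor
      · rintro ⟨y, hy, b, hb, rfl, rfl⟩
        exact ⟨by omega, hb, hy.2⟩
      · rintro ⟨h1, h2, h3⟩
        exact ⟨x, ⟨by omega, h3⟩, a, h2, rfl, rfl⟩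

/-- The successors of a configuration, given as input, state, and position. -/
def successors (E : OneHeadTable) (c : List ℕ × ℕ × ℕ) : List (List ℕ × ℕ × ℕ) :=
  E.filterMap fun e => if e.1 = c.2.1 ∧ e.2.1 = readNum c.1 c.2.2 then
    some (c.1, e.2.2.1, moveNum c.1.length e.2.2.2 c.2.2) else none

theorem mem_successors {c c' : List ℕ × ℕ × ℕ} :
    c' ∈ successors E c ↔ c'.1 = c.1 ∧ NumStep E c.1 c.2 c'.2 := by
  obtain ⟨x, q, p⟩ := c
  obtain ⟨x', q', p'⟩ := c'
  simp only [successors, List.mem_filterMap, NumStep, Option.ite_none_right_eq_some,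
    Option.some.injEq, Prod.mk.injEq, Prod.exists]
  constructor
  · rintro ⟨_, _, _, d, he, ⟨rfl, rfl⟩, rfl, rfl, rfl⟩
    exact ⟨rfl, d, he, rfl⟩
  · rintro ⟨rfl, d, he, rfl⟩
    exact ⟨_, _, _, d, he, ⟨rfl, rfl⟩, rfl, rfl, rfl⟩

/-- The configurations reached in `t` steps from one of the given configurations. -/
def reachedAfter (E : OneHeadTable) (l : List (List ℕ × ℕ × ℕ)) (t : ℕ) :
    List (List ℕ × ℕ × ℕ) :=
  Nat.rec l (fun _ l => l.flatMap (successors E)) t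

theorem mem_reachedAfter {l : List (List ℕ × ℕ × ℕ)} {t : ℕ} {c' : List ℕ × ℕ × ℕ} :
    c' ∈ reachedAfter E l t ↔ ∃ c ∈ l, c'.1 = c.1 ∧ NumPath E c.1 t c.2 c'.2 := by
  induction t generalizing c' with
  | zero =>
    simp only [reachedAfter, NumPath]
    exact ⟨fun h => ⟨c', h, rfl, rfl⟩, fun ⟨c, h, h1, h2⟩ => Prod.ext h1 h2 ▸ h⟩
  | succ t ih =>
    change c' ∈ (reachedAfter E l t).flatMap _ ↔ _
    simp only [List.mem_flatMap, mem_successors, ih, NumPath]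
    constructor
    · rintro ⟨⟨x, b⟩, ⟨c, hc, rfl, hp⟩, h1, hs⟩
      exact ⟨c, hc, h1, b, hp, hs⟩
    · rintro ⟨c, hc, h1, b, hp, hs⟩
      exact ⟨(c.1, b), ⟨c, hc, rfl, hp⟩, h1, hs⟩

/-- A bound for the length of a shortest nonterminating input of an automaton of `n` states. -/
def lengthBound (n : ℕ) : ℕ := 2 ^ ((n + 1) * (n + 1))

/-- The configurations reached in `n * (B + 2)` steps on the inputs of length at most `B`, where
`B` is the length bound. -/
def longRuns (E : OneHeadTable) (n m q : ℕ) : List (List ℕ × ℕ × ℕ) :=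
  reachedAfter E ((wordsUpTo m (lengthBound n)).map fun x => (x, q, 0)) (n * (lengthBound n + 2))

/-- The number of steps is the configuration count for the longest words searched, hence large
enough to force a repetition on the shorter ones too. -/
theorem longRuns_ne_nil_iff (hE : ∀ e ∈ E, e.2.2.1 < n) {m q : ℕ} (hq : q < n) :
    longRuns E n m q ≠ [] ↔ ∃ x : List ℕ, (∀ a ∈ x, a < m) ∧ ¬ Terminates E x (q, 0) := by
  constructor
  · intro h
    obtain ⟨c', hc'⟩ := List.exists_mem_of_ne_nil _ h
    obtain ⟨c, hc, -, hp⟩ := mem_reachedAfter.1 hc'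
    obtain ⟨x, hx, rfl⟩ := List.mem_map.1 hc
    obtain ⟨hl, hm⟩ := mem_wordsUpTo.1 hx
    exact ⟨x, hm, hp.not_terminates hE hq (by simp)
      (Nat.mul_le_mul le_rfl (Nat.add_le_add_right hl 2))⟩
  · intro h
    obtain ⟨x, hl, hm, ht⟩ := exists_short_not_terminates hE h
    obtain ⟨c', hc'⟩ := exists_numPath_of_not_terminates ht (n * (lengthBound n + 2))
    refine List.ne_nil_of_mem (a := (x, c')) (mem_reachedAfter.2 ⟨(x, q, 0), ?_, rfl, hc'⟩)
    exact List.mem_map.2 ⟨x, mem_wordsUpTo.2 ⟨hl, hm⟩, rfl⟩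

/-! ### The search is primitive recursive -/

section Primrec

open Primrec

theorem primrec_readNum : Primrec₂ readNum := by
  refine Primrec.ite (Primrec.eq.comp snd (const 0)) (const 0) ?_
  refine option_getD.comp (option_map (list_getElem?.comp fst (nat_sub.comp snd (const 1))) ?_)
    (const 1)
  exact (nat_add.comp snd (const 2)).to₂

theorem primrec_moveNum : Primrec fun a : ℕ × ℕ × ℕ => moveNum a.1 a.2.1 a.2.2 := by
  have hd : Primrec fun a : ℕ × ℕ × ℕ => a.2.1 := fst.comp snd
  have hp : Primrec fun a : ℕ × ℕ × ℕ => a.2.2 := snd.comp snd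
  refine Primrec.ite (Primrec.eq.comp hd (const 0)) (nat_sub.comp hp (const 1)) ?_
  refine Primrec.ite (Primrec.eq.comp hd (const 1)) hp ?_
  exact nat_min.comp (succ.comp hp) (succ.comp fst)

theorem primrec_wordsUpTo : Primrec₂ wordsUpTo := by
  have hword : Primrec₂ fun (y : ((ℕ × ℕ) × (ℕ × List (List ℕ))) × List ℕ) (a : ℕ) => a :: y.2 :=
    (list_cons.comp snd (snd.comp fst)).to₂
  have hmap : Primrec₂ fun (y : (ℕ × ℕ) × (ℕ × List (List ℕ))) (x : List ℕ) =>
      (List.range y.1.1).map fun a => a :: x :=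
    (list_map (list_range.comp (fst.comp (fst.comp fst))) hword).to₂
  have hstep : Primrec₂ fun (y : ℕ × ℕ) (z : ℕ × List (List ℕ)) =>
      ([] : List ℕ) :: z.2.flatMap fun x => (List.range y.1).map fun a => a :: x :=
    (list_cons.comp (const []) (list_flatMap (snd.comp snd) hmap)).to₂
  exact (nat_rec' snd (const [[]]) hstep).to₂

theorem primrec_successors : Primrec₂ successors := by
  let α := (OneHeadTable × (List ℕ × ℕ × ℕ)) × (ℕ × ℕ × ℕ × ℕ)
  have hx : Primrec fun y : α => y.1.2.1 := fst.comp (snd.comp fst)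
  have hq : Primrec fun y : α => y.1.2.2.1 := fst.comp (snd.comp (snd.comp fst))
  have hp : Primrec fun y : α => y.1.2.2.2 := snd.comp (snd.comp (snd.comp fst))
  have h1 : Primrec fun y : α => y.2.1 := fst.comp snd
  have h2 : Primrec fun y : α => y.2.2.1 := fst.comp (snd.comp snd)
  have h3 : Primrec fun y : α => y.2.2.2.1 := fst.comp (snd.comp (snd.comp snd))
  have h4 : Primrec fun y : α => y.2.2.2.2 := snd.comp (snd.comp (snd.comp snd))
  refine listFilterMap fst ?_
  exact Primrec.ite ((Primrec.eq.comp h1 hq).and (Primrec.eq.comp h2 (primrec_readNum.comp hx hp)))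
    (option_some.comp (hx.pair (h3.pair
      (primrec_moveNum.comp ((list_length.comp hx).pair (h4.pair hp)))))) (const none)

theorem primrec_reachedAfter :
    Primrec fun a : OneHeadTable × List (List ℕ × ℕ × ℕ) × ℕ => reachedAfter a.1 a.2.1 a.2.2 := by
  have hsucc : Primrec₂ fun (y : (OneHeadTable × List (List ℕ × ℕ × ℕ) × ℕ) ×
      (ℕ × List (List ℕ × ℕ × ℕ))) (c : List ℕ × ℕ × ℕ) => successors y.1.1 c :=
    (primrec_successors.comp (fst.comp (fst.comp fst)) snd).to₂
  exact nat_rec' (snd.comp snd) (fst.comp snd) (list_flatMap (snd.comp snd) hsucc).to₂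

theorem primrec_lengthBound : Primrec lengthBound :=
  (Primrec₂.unpaired'.1 Nat.Primrec.pow).comp (const 2) (nat_mul.comp succ succ)

theorem primrec_longRuns :
    Primrec fun a : OneHeadTable × ℕ × ℕ × ℕ => longRuns a.1 a.2.1 a.2.2.1 a.2.2.2 := by
  have hB : Primrec fun a : OneHeadTable × ℕ × ℕ × ℕ => lengthBound a.2.1 :=
    primrec_lengthBound.comp (fst.comp snd)
  refine primrec_reachedAfter.comp (fst.pair (Primrec.pair (list_map
    (primrec_wordsUpTo.comp (fst.comp (snd.comp snd)) hB) ?_)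
    (nat_mul.comp (fst.comp snd) (nat_add.comp hB (const 2)))))
  exact (snd.pair ((snd.comp (snd.comp (snd.comp fst))).pair (const 0))).to₂

end Primrec

end

/-! ### Translation between automata and numbered tables -/

theorem readNum_map_val {m : ℕ} (x : List (Fin m)) (p : Fin (x.length + 2)) :
    readNum (x.map Fin.val) p.val = (readTape x p).code := by
  unfold readNum readTape
  split_ifs with h
  · rfl
  · rw [List.getElem?_map]
    cases x[p.val - 1]? <;> rfl

theorem moveNum_code {N : ℕ} (p : Fin (N + 2)) (d : HeadMove) :
    moveNum N d.code p.val = (moveHead p d).val := by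
  cases d <;> rfl

namespace MultiheadNFA

/-- A step from a configuration that is not halted. -/
def LiveStep {k : ℕ} {Q S : Type} (M : MultiheadNFA k Q S) {x : List S} (c c' : Config k Q x) :
    Prop :=
  ¬ M.Halted c ∧ M.Step c c'

/-- An inaccessible configuration has an inaccessible successor, and dependent choice assembles
these into a path that never halts. Conversely, a path that never halts consists of live steps and
so cannot visit an accessible configuration. -/
theorem alwaysHalting_iff_acc {k : ℕ} {Q S : Type} (M : MultiheadNFA k Q S) :
    M.AlwaysHalting ↔ ∀ x, Acc (fun a b => M.LiveStep b a) (M.initConfig x) := by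
  constructor
  · intro h x
    by_contra hacc
    have hnext : ∀ c : {c : Config k Q x // ¬ Acc (fun a b => M.LiveStep b a) c},
        ∃ c' : {c : Config k Q x // ¬ Acc (fun a b => M.LiveStep b a) c},
          M.LiveStep c.1 c'.1 := by
      rintro ⟨c, hc⟩
      by_contra! hcon
      refine hc ⟨_, fun y hy => ?_⟩
      by_contra hy'
      exact hcon ⟨y, hy'⟩ hy
    choose g hg using hnext
    let p : ℕ → {c : Config k Q x // ¬ Acc (fun a b => M.LiveStep b a) c} :=
      fun t => g^[t] ⟨_, hacc⟩
    have hp : ∀ t, M.LiveStep (p t).1 (p (t + 1)).1 := by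
      intro t
      have : p (t + 1) = g (p t) := Function.iterate_succ_apply' g t _
      rw [this]
      exact hg _
    obtain ⟨t, ht⟩ := h x (fun t => (p t).1)
      ⟨rfl, fun t => ⟨fun _ => (hp t).2, fun hh => absurd hh (hp t).1⟩⟩
    exact (hp t).1 ht
  · rintro h x p ⟨h0, hp⟩
    by_contra! hcon
    have key : ∀ c, Acc (fun a b => M.LiveStep b a) c → ∀ t, p t ≠ c := by
      intro c hc
      induction hc with
      | intro c _ ih =>
        rintro t rfl
        exact ih (p (t + 1)) ⟨hcon t, (hp t).1 (hcon t)⟩ (t + 1) rfl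
    exact key _ (h x) 0 h0

/-- `E` lists the transitions of the one-head automaton `M` from states that do not halt. -/
def ListedBy {n m : ℕ} (M : MultiheadNFA 1 (Fin n) (Fin m)) (E : OneHeadTable) : Prop :=
  ∀ e, e ∈ E ↔ ∃ q z r d, q ≠ M.qacc ∧ q ≠ M.qrej ∧ (r, d) ∈ M.delta q z ∧
    e = (q.val, (z 0).code, r.val, (d 0).code)

/-- The numbered form of a configuration of a one-head automaton. -/
def numConfig {n m : ℕ} {x : List (Fin m)} (c : Config 1 (Fin n) x) : ℕ × ℕ :=
  (c.1.val, (c.2 0).val)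

variable {n m : ℕ} {M : MultiheadNFA 1 (Fin n) (Fin m)} {E : OneHeadTable}

theorem LiveStep.numStep (hE : M.ListedBy E) {x : List (Fin m)} {c c' : Config 1 (Fin n) x}
    (h : M.LiveStep c c') : NumStep E (x.map Fin.val) (numConfig c) (numConfig c') := by
  obtain ⟨hh, ⟨r, d⟩, he, rfl⟩ := h
  simp only [Halted, not_or] at hh
  refine ⟨(d 0).code, ?_, ?_⟩
  · refine (hE _).2 ⟨c.1, _, r, d, hh.1, hh.2.1, he, ?_⟩
    simp only [numConfig, readNum_map_val]
  · simp only [numConfig, List.length_map, moveNum_code]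

/-- Together with `LiveStep.numStep` this makes `numConfig` a bisimulation, along which
accessibility transfers. The new step is live because the table omits transitions from the accept
and reject states, and the matched transition is itself an available option. -/
theorem exists_liveStep_of_numStep (hE : M.ListedBy E) {x : List (Fin m)} {c : Config 1 (Fin n) x}
    {b : ℕ × ℕ} (h : NumStep E (x.map Fin.val) (numConfig c) b) :
    ∃ c', b = numConfig c' ∧ M.LiveStep c c' := by
  obtain ⟨d', he, hm⟩ := h
  obtain ⟨q, z, r, d, ha, hr, hd, heq⟩ := (hE _).1 he
  simp only [numConfig, readNum_map_val, Prod.mk.injEq] at heq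
  obtain ⟨h1, h2, h3, rfl⟩ := heq
  obtain rfl := Fin.ext h1
  have hz : (fun j => readTape x (c.2 j)) = z := by
    funext j
    rw [Subsingleton.elim j 0]
    exact TapeSym.code_injective h2
  have hopt : (r, d) ∈ M.options c := by
    unfold options
    rwa [hz]
  refine ⟨(r, fun j => moveHead (c.2 j) (d j)), ?_, ?_, (r, d), hopt, rfl⟩
  · refine Prod.ext h3 ?_
    rw [hm]
    simp only [numConfig, List.length_map, moveNum_code]
  · rintro (h | h | h)
    · exact ha h
    · exact hr h
    · rw [h] at hopt
      exact hopt

theorem acc_liveStep_iff (hE : M.ListedBy E) {x : List (Fin m)} (c : Config 1 (Fin n) x) :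
    Acc (fun a b => M.LiveStep b a) c ↔ Terminates E (x.map Fin.val) (numConfig c) := by
  constructor
  · intro h
    induction h with
    | intro c _ ih =>
      refine ⟨_, fun b hb => ?_⟩
      obtain ⟨c', rfl, hs⟩ := exists_liveStep_of_numStep hE hb
      exact ih c' hs
  · intro h
    generalize hb : numConfig c = b at h
    induction h generalizing c with
    | intro b _ ih =>
      subst hb
      exact ⟨_, fun c' hs => ih _ (hs.numStep hE) c' rfl⟩

theorem not_alwaysHalting_iff (hE : M.ListedBy E) :
    ¬ M.AlwaysHalting ↔ longRuns E n m M.q0.val ≠ [] := by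
  have hlt : ∀ e ∈ E, e.2.2.1 < n := by
    intro e he
    obtain ⟨q, z, r, d, -, -, -, rfl⟩ := (hE e).1 he
    exact r.isLt
  rw [longRuns_ne_nil_iff hlt M.q0.isLt, alwaysHalting_iff_acc]
  push Not
  constructor
  · rintro ⟨x, hx⟩
    refine ⟨x.map Fin.val, fun a ha => ?_, fun h => hx ((acc_liveStep_iff hE _).2 h)⟩
    obtain ⟨b, -, rfl⟩ := List.mem_map.1 ha
    exact b.isLt
  · rintro ⟨y, hy, hT⟩
    obtain ⟨x, rfl⟩ : ∃ x : List (Fin m), x.map Fin.val = y :=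
      ⟨y.attach.map fun a => ⟨a.1, hy a.1 a.2⟩, by simp⟩
    exact ⟨x, fun h => hT ((acc_liveStep_iff hE _).1 h)⟩

/-- This reduces the always halting property of one-head automata to safety of a head. -/
theorem headNFA_zero (M : MultiheadNFA 1 (Fin n) (Fin m)) : M.headNFA 0 = M := by
  have : (M.headNFA 0).delta = M.delta := by
    funext q z
    ext ⟨r, d⟩
    constructor
    · rintro ⟨y, hy, r', d', h, he⟩
      simp only [Prod.mk.injEq] at he
      obtain ⟨rfl, rfl⟩ := he
      have h1 : y = z := funext fun j => by rw [Subsingleton.elim j 0]; exact hy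
      have h2 : (fun _ => d' 0) = d' := funext fun j => by rw [Subsingleton.elim j 0]
      rwa [h2, ← h1]
    · intro h
      refine ⟨z, rfl, r, d, h, ?_⟩
      rw [Prod.mk.injEq]
      exact ⟨rfl, funext fun j => by rw [Subsingleton.elim j 0]⟩
  cases M
  simp only [headNFA] at this ⊢
  rw [this]

end MultiheadNFA

/-! ### Reading codes of multi-head automata -/

/-- The numbered transitions of the one-head automaton of head `i` from states that do not halt,
extracted from an encoding. -/
def headTable (c : AutomatonCode) (i : ℕ) : OneHeadTable :=
  c.2.2.2.2.2.2.filterMap fun e =>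
    if e.1 = c.2.2.2.2.1 ∨ e.1 = c.2.2.2.2.2.1 then none
    else some (e.1, e.2.1.getD i 0, e.2.2.1, e.2.2.2.getD i 0)

theorem listedBy_headTable {k n m : ℕ} {c : AutomatonCode} {M : MultiheadNFA k (Fin n) (Fin m)}
    (h : Encodes c M) (i : Fin k) : (M.headNFA i).ListedBy (headTable c i) := by
  obtain ⟨L, rfl, hL⟩ := h
  intro e
  simp only [headTable, List.mem_filterMap, Option.ite_none_left_eq_some, Option.some.injEq, hL,
    not_or]
  constructor
  · rintro ⟨_, ⟨q, y, r, d, hd, rfl⟩, ⟨ha, hr⟩, rfl⟩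
    refine ⟨q, fun _ => y i, r, fun _ => d i, fun h => ha (congrArg Fin.val h),
      fun h => hr (congrArg Fin.val h), ⟨y, rfl, r, d, hd, rfl⟩, ?_⟩
    -- The default `0` in `headTable` is never used: the lists have length `k` and `i < k`.
    simp [transitionCode]
  · rintro ⟨q, z, r', d', ha, hr, ⟨y, hy, r, d, hd, he⟩, rfl⟩
    simp only [Prod.mk.injEq] at he
    obtain ⟨rfl, rfl⟩ := he
    refine ⟨_, ⟨q, y, r', d, hd, rfl⟩, ⟨fun h => ha (Fin.ext h), fun h => hr (Fin.ext h)⟩, ?_⟩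
    simp [transitionCode, hy]

/-- The number of states, of input symbols, and the three special states fit together, and the
transitions are transitions of an automaton with these parameters. -/
def WellFormed (c : AutomatonCode) : Prop :=
  (c.2.2.2.1 < c.2.1 ∧ c.2.2.2.2.1 < c.2.1 ∧ c.2.2.2.2.2.1 < c.2.1) ∧
    ∀ e ∈ c.2.2.2.2.2.2, (e.1 < c.2.1 ∧ e.2.2.1 < c.2.1) ∧
      (e.2.1.length = c.1 ∧ ∀ a ∈ e.2.1, a < c.2.2.1 + 2) ∧
      (e.2.2.2.length = c.1 ∧ ∀ a ∈ e.2.2.2, a < 3)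

theorem TapeSym.code_lt {m : ℕ} (a : TapeSym (Fin m)) : a.code < m + 2 := by
  cases a <;> simp [TapeSym.code]

theorem TapeSym.exists_code_eq {m a : ℕ} (h : a < m + 2) : ∃ z : TapeSym (Fin m), z.code = a := by
  match a, h with
  | 0, _ => exact ⟨.leftEnd, rfl⟩
  | 1, _ => exact ⟨.rightEnd, rfl⟩
  | a + 2, h => exact ⟨.sym ⟨a, by omega⟩, rfl⟩

theorem HeadMove.code_lt (d : HeadMove) : d.code < 3 := by
  cases d <;> simp [HeadMove.code]

theorem HeadMove.exists_code_eq {a : ℕ} (h : a < 3) : ∃ d : HeadMove, d.code = a := by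
  match a, h with
  | 0, _ => exact ⟨.left, rfl⟩
  | 1, _ => exact ⟨.stay, rfl⟩
  | 2, _ => exact ⟨.right, rfl⟩

theorem List.exists_ofFn_comp_eq {α : Type} {f : α → ℕ} {l : List ℕ} {k : ℕ} (hl : l.length = k)
    (h : ∀ a ∈ l, ∃ z, f z = a) : ∃ y : Fin k → α, l = List.ofFn fun j => f (y j) := by
  subst hl
  choose g hg using fun j : Fin l.length => h l[j] (List.getElem_mem _)
  refine ⟨g, ?_⟩
  simp only [hg]
  exact (List.ofFn_getElem (xs := l)).symm

/-- The transition function is recovered as membership in the list. The bounds on lengths and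
entries ensure that every listed item decodes to a genuine transition, so that nothing in the list
is left over. -/
theorem wellFormed_iff {c : AutomatonCode} :
    WellFormed c ↔ ∃ M : MultiheadNFA c.1 (Fin c.2.1) (Fin c.2.2.1), Encodes c M := by
  constructor
  · obtain ⟨k, n, m, q0, qa, qr, L⟩ := c
    rintro ⟨⟨h0, ha, hr⟩, hL⟩
    refine ⟨⟨fun q y => {e | transitionCode q y e.1 e.2 ∈ L}, ⟨q0, h0⟩, ⟨qa, ha⟩, ⟨qr, hr⟩⟩,
      L, rfl, fun e => ⟨fun he => ?_, ?_⟩⟩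
    · obtain ⟨⟨h1, h2⟩, ⟨h3, h4⟩, h5, h6⟩ := hL e he
      obtain ⟨q, ys, r, ds⟩ := e
      obtain ⟨y, rfl⟩ := List.exists_ofFn_comp_eq h3 fun a ha => TapeSym.exists_code_eq (h4 a ha)
      obtain ⟨d, rfl⟩ := List.exists_ofFn_comp_eq h5 fun a ha => HeadMove.exists_code_eq (h6 a ha)
      exact ⟨⟨q, h1⟩, y, ⟨r, h2⟩, d, he, rfl⟩
    · rintro ⟨q, y, r, d, h, rfl⟩
      exact h
  · rintro ⟨M, L, hc, hL⟩
    rw [hc]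
    refine ⟨⟨M.q0.isLt, M.qacc.isLt, M.qrej.isLt⟩, fun e he => ?_⟩
    obtain ⟨q, y, r, d, -, rfl⟩ := (hL e).1 he
    refine ⟨⟨q.isLt, r.isLt⟩, ⟨List.length_ofFn, fun a ha => ?_⟩, List.length_ofFn, fun a ha => ?_⟩
    · obtain ⟨j, rfl⟩ := List.mem_ofFn.1 ha
      exact TapeSym.code_lt _
    · obtain ⟨j, rfl⟩ := List.mem_ofFn.1 ha
      exact HeadMove.code_lt _

/-- The configurations after long computations of the one-head automaton of head `i`. -/
def headRuns (p : AutomatonCode × ℕ) : List (List ℕ × ℕ × ℕ) :=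
  longRuns (headTable p.1 p.2) p.1.2.1 p.1.2.2.1 p.1.2.2.2.1

/-- The criterion depends on the code alone, so it serves every automaton that the code encodes. -/
theorem riskyHead_iff {k n m : ℕ} {c : AutomatonCode} {M : MultiheadNFA k (Fin n) (Fin m)}
    (h : Encodes c M) (i : Fin k) : M.RiskyHead i ↔ headRuns (c, i.val) ≠ [] := by
  have := MultiheadNFA.not_alwaysHalting_iff (listedBy_headTable h i)
  obtain ⟨L, rfl, -⟩ := h
  exact this

theorem Encodes.wellFormed {k n m : ℕ} {c : AutomatonCode} {M : MultiheadNFA k (Fin n) (Fin m)}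
    (h : Encodes c M) : c.1 = k ∧ WellFormed c := by
  obtain ⟨L, rfl, hL⟩ := h
  exact ⟨rfl, wellFormed_iff.2 ⟨M, L, rfl, hL⟩⟩

/-- Pairs with an invalid code or head index lie in neither set, so the risky pairs are not simply
the complement of the safe ones and validity has to be tested for both. -/
theorem mem_riskyHeads_iff {p : AutomatonCode × ℕ} :
    p ∈ RiskyHeads ↔ (WellFormed p.1 ∧ p.2 < p.1.1) ∧ ¬ headRuns p = [] := by
  obtain ⟨c, j⟩ := p
  constructor
  · rintro ⟨k, n, m, M, i, h, hi, hr⟩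
    obtain rfl : j = i.val := hi
    obtain ⟨hk, hw⟩ := h.wellFormed
    exact ⟨⟨hw, i.isLt.trans_eq hk.symm⟩, (riskyHead_iff h i).1 hr⟩
  · rintro ⟨⟨hw, hj⟩, hr⟩
    obtain ⟨M, hM⟩ := wellFormed_iff.1 hw
    exact ⟨_, _, _, M, ⟨j, hj⟩, hM, rfl, (riskyHead_iff hM ⟨j, hj⟩).2 hr⟩

theorem mem_safeHeads_iff {p : AutomatonCode × ℕ} :
    p ∈ SafeHeads ↔ (WellFormed p.1 ∧ p.2 < p.1.1) ∧ headRuns p = [] := by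
  obtain ⟨c, j⟩ := p
  constructor
  · rintro ⟨k, n, m, M, i, h, hi, hs⟩
    obtain rfl : j = i.val := hi
    obtain ⟨hk, hw⟩ := h.wellFormed
    refine ⟨⟨hw, i.isLt.trans_eq hk.symm⟩, ?_⟩
    by_contra hr
    exact (riskyHead_iff h i).2 hr hs
  · rintro ⟨⟨hw, hj⟩, hr⟩
    obtain ⟨M, hM⟩ := wellFormed_iff.1 hw
    refine ⟨_, _, _, M, ⟨j, hj⟩, hM, rfl, ?_⟩
    by_contra hs
    exact (riskyHead_iff hM ⟨j, hj⟩).1 hs hr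

theorem mem_decider2NFA_iff {c : AutomatonCode} :
    c ∈ Decider2NFA ↔ c.1 = 1 ∧ (c, 0) ∈ SafeHeads := by
  constructor
  · rintro ⟨n, m, M, h, hM⟩
    refine ⟨h.wellFormed.1, 1, n, m, M, 0, h, rfl, ?_⟩
    rwa [MultiheadNFA.SafeHead, M.headNFA_zero]
  · rintro ⟨hc, k, n, m, M, i, h, hi, hs⟩
    obtain rfl : k = 1 := h.wellFormed.1.symm.trans hc
    obtain rfl : i = 0 := Subsingleton.elim _ _
    rw [MultiheadNFA.SafeHead, M.headNFA_zero] at hs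
    exact ⟨n, m, M, h, hs⟩

/-! ### The decision procedures are primitive recursive -/

section Primrec

open Primrec

theorem primrec_headTable : Primrec₂ headTable := by
  let α := (AutomatonCode × ℕ) × TransitionCode
  have hqa : Primrec fun y : α => y.1.1.2.2.2.2.1 :=
    fst.comp <| snd.comp <| snd.comp <| snd.comp <| snd.comp <| fst.comp fst
  have hqr : Primrec fun y : α => y.1.1.2.2.2.2.2.1 :=
    fst.comp <| snd.comp <| snd.comp <| snd.comp <| snd.comp <| snd.comp <| fst.comp fst
  have hi : Primrec fun y : α => y.1.2 := snd.comp fst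
  have h1 : Primrec fun y : α => y.2.1 := fst.comp snd
  have h2 : Primrec fun y : α => y.2.2.1 := fst.comp (snd.comp snd)
  have h3 : Primrec fun y : α => y.2.2.2.1 := fst.comp (snd.comp (snd.comp snd))
  have h4 : Primrec fun y : α => y.2.2.2.2 := snd.comp (snd.comp (snd.comp snd))
  refine listFilterMap
    (snd.comp <| snd.comp <| snd.comp <| snd.comp <| snd.comp <| snd.comp fst) ?_
  exact Primrec.ite ((Primrec.eq.comp h1 hqa).or (Primrec.eq.comp h1 hqr)) (const none)
    (option_some.comp (h1.pair (((list_getD 0).comp h2 hi).pair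
      (h3.pair ((list_getD 0).comp h4 hi)))))

theorem primrec_headRuns : Primrec headRuns := by
  have h : Primrec fun p : AutomatonCode × ℕ =>
      (headTable p.1 p.2, p.1.2.1, p.1.2.2.1, p.1.2.2.2.1) :=
    (primrec_headTable.comp fst snd).pair <|
      (fst.comp (snd.comp fst)).pair <| (fst.comp (snd.comp (snd.comp fst))).pair
        (fst.comp (snd.comp (snd.comp (snd.comp fst))))
  exact (primrec_longRuns.comp h).of_eq fun _ => rfl

theorem primrecPred_wellFormed : PrimrecPred WellFormed := by
  have hn : Primrec fun c : AutomatonCode => c.2.1 := fst.comp snd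
  have hm : Primrec fun c : AutomatonCode => c.2.2.1 := fst.comp (snd.comp snd)
  have hall : PrimrecRel fun (l : List ℕ) (b : ℕ) => ∀ a ∈ l, a < b := nat_lt.forall_mem_list
  refine ((nat_lt.comp (fst.comp <| snd.comp <| snd.comp snd) hn).and
    ((nat_lt.comp (fst.comp <| snd.comp <| snd.comp <| snd.comp snd) hn).and
    (nat_lt.comp (fst.comp <| snd.comp <| snd.comp <| snd.comp <| snd.comp snd) hn))).and ?_
  have hrel : PrimrecRel fun (e : TransitionCode) (c : AutomatonCode) =>
      (e.1 < c.2.1 ∧ e.2.2.1 < c.2.1) ∧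
      (e.2.1.length = c.1 ∧ ∀ a ∈ e.2.1, a < c.2.2.1 + 2) ∧
      (e.2.2.2.length = c.1 ∧ ∀ a ∈ e.2.2.2, a < 3) := by
    have h1 : Primrec fun y : TransitionCode × AutomatonCode => y.1.1 := fst.comp fst
    have h2 : Primrec fun y : TransitionCode × AutomatonCode => y.1.2.1 := fst.comp (snd.comp fst)
    have h3 : Primrec fun y : TransitionCode × AutomatonCode => y.1.2.2.1 :=
      fst.comp (snd.comp (snd.comp fst))
    have h4 : Primrec fun y : TransitionCode × AutomatonCode => y.1.2.2.2 :=
      snd.comp (snd.comp (snd.comp fst))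
    have hk : Primrec fun y : TransitionCode × AutomatonCode => y.2.1 := fst.comp snd
    have hn' := hn.comp (snd (α := TransitionCode))
    have hm' := hm.comp (snd (α := TransitionCode))
    exact ((nat_lt.comp h1 hn').and (nat_lt.comp h3 hn')).and
      (((Primrec.eq.comp (list_length.comp h2) hk).and
        (hall.comp h2 (nat_add.comp hm' (const 2)))).and
      ((Primrec.eq.comp (list_length.comp h4) hk).and (hall.comp h4 (const 3))))
  exact hrel.forall_mem_list.comp
    (snd.comp <| snd.comp <| snd.comp <| snd.comp <| snd.comp snd) Primrec.id

theorem primrecPred_head :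
    PrimrecPred fun p : AutomatonCode × ℕ => WellFormed p.1 ∧ p.2 < p.1.1 :=
  (primrecPred_wellFormed.comp fst).and (nat_lt.comp snd (fst.comp fst))

theorem primrecPred_headRuns_eq_nil :
    PrimrecPred fun p : AutomatonCode × ℕ => headRuns p = [] :=
  Primrec.eq.comp primrec_headRuns (const [])

theorem primrecPred_safeHeads : PrimrecPred fun p : AutomatonCode × ℕ => p ∈ SafeHeads :=
  (primrecPred_head.and primrecPred_headRuns_eq_nil).of_eq fun _ => mem_safeHeads_iff.symm

theorem primrecPred_riskyHeads : PrimrecPred fun p : AutomatonCode × ℕ => p ∈ RiskyHeads :=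
  (primrecPred_head.and primrecPred_headRuns_eq_nil.not).of_eq fun _ => mem_riskyHeads_iff.symm

theorem primrecPred_decider2NFA : PrimrecPred fun c : AutomatonCode => c ∈ Decider2NFA :=
  ((Primrec.eq.comp fst (const 1)).and
    (primrecPred_safeHeads.comp (Primrec.id.pair (const 0)))).of_eq
      fun _ => mem_decider2NFA_iff.symm

end Primrec

theorem mainTheorem6 :
    ComputablePred (fun c : AutomatonCode => c ∈ Decider2NFA) ∧
    ComputablePred (fun p : AutomatonCode × ℕ => p ∈ SafeHeads) ∧
    ComputablePred (fun p : AutomatonCode × ℕ => p ∈ RiskyHeads) := by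
  exact ⟨primrecPred_decider2NFA.computablePred, primrecPred_safeHeads.computablePred,
    primrecPred_riskyHeads.computablePred⟩
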